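/- Let $\Sigma\subsetneq\mathbb S^2$ be a Lipschitz domain in the unit sphere of $\mathbb R^3$, that is, a nonempty connected open set which, near each of its boundary points, is the region above the graph of a Lipschitz function of one variable in suitable smooth local coordinates. Let $\rho$ be smooth in $\Sigma$ and Lipschitz on $\overline\Sigma$ (that is, $\rho\in C^\infty(\Sigma)\cap\mathrm{Lip}(\overline\Sigma)$), positive in $\Sigma$, and suppose that $$\rho\,\Delta\rho+\tfrac12\rho^2=\tfrac32\big(|\nabla\rho|^2-1\big)\quad\text{in }\Sigma,\qquad \rho=0\quad\text{on }\partial\Sigma,$$ where $\nabla$ and $\Delta$ are the gradient and the Laplace-Beltrami operator of the round metric on $\mathbb S^2$. Then $$\rho<4.2\quad\text{and}\quad|\nabla\rho|<2.8\qquad\text{in }\Sigma.$$ -/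

import Mathlib

open scoped Manifold ContDiff Laplacian

noncomputable section

/-- The unit sphere `𝕊²` of `ℝ³`, with Mathlib's topology and smooth structure. -/
abbrev S2 : Type := Metric.sphere (0 : EuclideanSpace ℝ (Fin 3)) 1

/-- The radially constant extension `x ↦ f (x / |x|)` of a function `f` on `𝕊²` to `ℝ³ \ {0}`
(with the irrelevant value `0` at the origin). -/
def radialExt (f : S2 → ℝ) (x : EuclideanSpace ℝ (Fin 3)) : ℝ :=
  if hx : x ≠ 0 then
    f ⟨‖x‖⁻¹ • x, by
      rw [mem_sphere_zero_iff_norm, norm_smul, norm_inv, norm_norm,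
        inv_mul_cancel₀ (norm_ne_zero_iff.mpr hx)]⟩
  else 0

/-- The gradient of `f` on the round sphere `𝕊²`, as a vector of `ℝ³` tangent to the sphere.
The radial derivative of the extension vanishes, so its Euclidean gradient at a point of the sphere
is the tangential gradient of `f`. -/
def sphereGradient (f : S2 → ℝ) (θ : S2) : EuclideanSpace ℝ (Fin 3) :=
  gradient (radialExt f) (θ : EuclideanSpace ℝ (Fin 3))

/-- The Laplace-Beltrami operator of the round sphere `𝕊²`. In polar coordinates
`Δ = ∂_rr + (2 / r) ∂_r + r⁻² Δ_{𝕊²}`, so that on radially constant functions the Euclidean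
Laplacian at `r = 1` is `Δ_{𝕊²}`. -/
def sphereLaplacian (f : S2 → ℝ) (θ : S2) : ℝ :=
  (Δ (radialExt f)) (θ : EuclideanSpace ℝ (Fin 3))

/-- Lipschitz domains of `𝕊²`: nonempty connected open sets that, near each boundary point, are
the region above the graph of a Lipschitz function of one variable in suitable
smooth local coordinates. -/
structure IsLipschitzDomain (D : Set S2) : Prop where
  isOpen : IsOpen D
  isConnected : IsConnected D
  locally_epigraph : ∀ p ∈ frontier D,
    ∃ e ∈ IsManifold.maximalAtlas (𝓡 2) ∞ S2, ∃ U : Set S2, IsOpen U ∧ p ∈ U ∧ U ⊆ e.source ∧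
      ∃ (g : ℝ → ℝ) (K : NNReal), LipschitzWith K g ∧
        ∀ q ∈ U, (q ∈ D ↔ g (e q 0) < e q 1)

end

/-!
The function `f = radialExt ρ` is constant on rays, and on the open cone over `D` it is a smooth
solution of `|x|² f Δf + f² / 2 = 3 / 2 (|x|² |∇f|² - 1)`, so everything can be computed in `ℝ³`
(`IsConeSolution`). Equivalently, `|x| f` solves the Loewner–Nirenberg equation
`v Δv = 3 / 2 (|∇v|² - 1)` on the cone.

*Bound on `ρ`.* A Lipschitz domain other than the sphere has an exterior point `p`. In terms of
`y`, the cosine of half the distance to `-p`, the function `B = 2√3 y + (√6 - √3) y²` is positive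
away from `p` and satisfies `B ΔB + B² / 2 ≤ 3 / 2 (|∇B|² - 1)`. At an interior maximum of `ρ / B`
with value `k`, the functions `ρ` and `k B` touch to first order and `Δρ ≤ k ΔB`; inserting this in
the equation gives `k ≤ 1` (`IsConeSolution.le_one_of_contact`). Hence `ρ ≤ B ≤ √3 + √6 < 4.2`
(`solution_lt`).

*Bound on `∇ρ`.* Write `G = |∇ρ|²` and `s = ρ²`. At an interior maximum of `G + a s` where `∇ρ ≠ 0`,
the first-order conditions make `∇ρ` an eigenvector of the Hessian with eigenvalue `-a ρ`. Bochner's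
formula and the equation then express the Laplacian of `G + a s`, up to a positive factor, as the
product of `3 / 2 (G - 1) + (2 a - 1 / 2) s` and `1 / 2 (G - 3) + (a - 1 / 2) s`, which therefore
cannot be positive. Nothing is known about the regularity of the boundary, so a maximum is forced to
exist in `D` by the penalty `ε log ρ`; the bound on `G` that comes from the Lipschitz condition
shows that it perturbs the product by `O(ε)` only (`IsConeSolution.factor_mul_factor_le`,
`gradient_sq_add_le`). With `s < 4.2²`, the choice `a = 0.585` gives `G + 0.585 s ≤ 10.4`; with this
additional information the choice `a = 0` gives `G ≤ 7.8 < 2.8²`.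
-/

open Filter Topology

/-! ### Directional derivatives in `ℝ³` -/

/-- The Euclidean space `ℝ³`. -/
abbrev E3 : Type := EuclideanSpace ℝ (Fin 3)

/-- The derivative of `f` in the direction `v`, as a function of the base point. -/
noncomputable def dirDeriv (v : E3) (f : E3 → ℝ) (x : E3) : ℝ := fderiv ℝ f x v

theorem ContDiffOn.dirDeriv {V : Set E3} {f : E3 → ℝ} (hf : ContDiffOn ℝ ∞ f V) (hV : IsOpen V)
    (v : E3) : ContDiffOn ℝ ∞ (dirDeriv v f) V :=
  (hf.fderiv_of_isOpen hV (by simp)).clm_apply contDiffOn_const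

theorem ContDiffOn.hasDerivAt_line {V : Set E3} {f : E3 → ℝ} (hf : ContDiffOn ℝ ∞ f V)
    (hV : IsOpen V) {x v : E3} {t : ℝ} (hx : x + t • v ∈ V) :
    HasDerivAt (fun s : ℝ => f (x + s • v)) (_root_.dirDeriv v f (x + t • v)) t := by
  have h1 : HasFDerivAt f (fderiv ℝ f (x + t • v)) (x + t • v) :=
    ((hf.contDiffAt (hV.mem_nhds hx)).differentiableAt (by simp)).hasFDerivAt
  have h2 : HasDerivAt (fun s : ℝ => x + s • v) v t := by
    simpa using ((hasDerivAt_id t).smul_const v).const_add x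
  exact h1.comp_hasDerivAt t h2

theorem IsOpen.eventually_line_mem {V : Set E3} (hV : IsOpen V) {x : E3} (hx : x ∈ V) (v : E3) :
    ∀ᶠ t in 𝓝 (0 : ℝ), x + t • v ∈ V := by
  have h : ContinuousAt (fun t : ℝ => x + t • v) 0 := by fun_prop
  exact h.eventually (hV.mem_nhds (by simpa using hx))

theorem dirDeriv_dirDeriv {V : Set E3} {f : E3 → ℝ} (hf : ContDiffOn ℝ ∞ f V)
    (hV : IsOpen V) {x : E3} (hx : x ∈ V) (v w : E3) :
    dirDeriv v (dirDeriv w f) x = fderiv ℝ (fderiv ℝ f) x v w := by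
  have h : DifferentiableAt ℝ (fderiv ℝ f) x :=
    ((hf.fderiv_of_isOpen hV (m := ∞) (by simp)).contDiffAt (hV.mem_nhds hx)).differentiableAt
      (by simp)
  have := (h.hasFDerivAt.clm_apply (hasFDerivAt_const w x)).fderiv
  unfold dirDeriv
  rw [this]
  simp

theorem dirDeriv_comm {V : Set E3} {f : E3 → ℝ} (hf : ContDiffOn ℝ ∞ f V)
    (hV : IsOpen V) {x : E3} (hx : x ∈ V) (v w : E3) :
    dirDeriv v (dirDeriv w f) x = dirDeriv w (dirDeriv v f) x := by
  rw [dirDeriv_dirDeriv hf hV hx, dirDeriv_dirDeriv hf hV hx]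
  exact ((hf.contDiffAt (hV.mem_nhds hx)).isSymmSndFDerivAt
    (by simpa using (WithTop.coe_le_coe.2 le_top : (2 : ℕ∞ω) ≤ ∞))).eq v w

theorem dirDeriv_congr {V : Set E3} (hV : IsOpen V) {f g : E3 → ℝ} (h : Set.EqOn f g V)
    {x : E3} (hx : x ∈ V) (v : E3) : dirDeriv v f x = dirDeriv v g x := by
  unfold dirDeriv
  rw [(h.eventuallyEq_of_mem (hV.mem_nhds hx)).fderiv_eq]

theorem laplacian_eq_sum_dirDeriv {V : Set E3} {f : E3 → ℝ} (hf : ContDiffOn ℝ ∞ f V)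
    (hV : IsOpen V) {x : E3} (hx : x ∈ V) (b : OrthonormalBasis (Fin 3) ℝ E3) :
    (Δ f) x = ∑ i, dirDeriv (b i) (dirDeriv (b i) f) x := by
  rw [InnerProductSpace.laplacian_eq_iteratedFDeriv_orthonormalBasis f b]
  refine Finset.sum_congr rfl fun i _ => ?_
  rw [iteratedFDeriv_two_apply, dirDeriv_dirDeriv hf hV hx]
  simp

theorem inner_gradient (f : E3 → ℝ) (x v : E3) : inner ℝ (gradient f x) v = dirDeriv v f x := by
  simp [gradient, dirDeriv]

theorem norm_gradient_sq (f : E3 → ℝ) (x : E3) (b : OrthonormalBasis (Fin 3) ℝ E3) :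
    ‖gradient f x‖ ^ 2 = ∑ i, dirDeriv (b i) f x ^ 2 := by
  rw [← b.sum_sq_norm_inner_left (gradient f x)]
  simp only [inner_gradient, Real.norm_eq_abs, sq_abs]

/-- The necessary conditions for a local maximum on the line, for a function given together with
its first derivative near the point and its second derivative at the point. -/
theorem IsLocalMax.first_second_deriv {q q₁ : ℝ → ℝ} {q₂ x : ℝ} (hmax : IsLocalMax q x)
    (h₁ : ∀ᶠ t in 𝓝 x, HasDerivAt q (q₁ t) t) (h₂ : HasDerivAt q₁ q₂ x) :
    q₁ x = 0 ∧ q₂ ≤ 0 := by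
  have hd : deriv q =ᶠ[𝓝 x] q₁ := h₁.mono fun t ht => ht.deriv
  have hz : q₁ x = 0 := hmax.hasDerivAt_eq_zero h₁.self_of_nhds
  refine ⟨hz, not_lt.1 fun hpos => ?_⟩
  have hdd : deriv (deriv q) x = q₂ := by rw [hd.deriv_eq, h₂.deriv]
  have hmin : IsLocalMin q x := isLocalMin_of_deriv_deriv_pos (by rwa [hdd])
    (by rw [hd.self_of_nhds, hz]) h₁.self_of_nhds.continuousAt
  -- A local maximum that is also a local minimum is locally constant.
  have hc : q =ᶠ[𝓝 x] fun _ => q x := by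
    filter_upwards [hmax, hmin] with t h h' using le_antisymm h h'
  have hc' : deriv q =ᶠ[𝓝 x] fun _ => 0 := by
    simpa using hc.deriv
  have : deriv (deriv q) x = 0 := by simpa using hc'.deriv_eq
  linarith

/-! ### Radially constant functions -/

/-- `f` is constant on the open rays issuing from the origin. -/
def IsRadial (f : E3 → ℝ) : Prop := ∀ (s : ℝ) (x : E3), 0 < s → f (s • x) = f x

theorem IsRadial.dirDeriv_smul {f : E3 → ℝ} (hf : IsRadial f) {s : ℝ} (hs : 0 < s) (v x : E3) :
    dirDeriv v f (s • x) = s⁻¹ * dirDeriv v f x := by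
  have h : fderiv ℝ f x = s • fderiv ℝ f (s • x) := by
    rw [← fderiv_comp_smul]
    congr 1
    ext y
    exact (hf s y hs).symm
  simp only [dirDeriv, h]
  simp [hs.ne']

theorem IsRadial.dirDeriv_dirDeriv_smul {f : E3 → ℝ} (hf : IsRadial f) {s : ℝ} (hs : 0 < s)
    (v w x : E3) :
    dirDeriv v (dirDeriv w f) (s • x) = (s ^ 2)⁻¹ * dirDeriv v (dirDeriv w f) x := by
  have h : s • fderiv ℝ (dirDeriv w f) (s • x) = s⁻¹ • fderiv ℝ (dirDeriv w f) x := by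
    have hfun : (fun y => dirDeriv w f (s • y)) = s⁻¹ • dirDeriv w f := by
      ext y
      exact hf.dirDeriv_smul hs w y
    rw [← fderiv_comp_smul, hfun, fderiv_const_smul_field]
    rfl
  have h' := congrArg (fun L => s⁻¹ * L v) h
  simp only [smul_apply, smul_eq_mul] at h'
  rw [inv_mul_cancel_left₀ hs.ne'] at h'
  rw [dirDeriv, h', dirDeriv]
  field_simp

theorem IsRadial.dirDeriv_self {f : E3 → ℝ} (hf : IsRadial f) {V : Set E3} (hV : IsOpen V)
    (hfV : ContDiffOn ℝ ∞ f V) {x : E3} (hx : x ∈ V) : dirDeriv x f x = 0 := by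
  have h := hfV.hasDerivAt_line hV (x := x) (v := x) (t := 0) (by simpa using hx)
  have hc : (fun s : ℝ => f (x + s • x)) =ᶠ[𝓝 0] fun _ => f x := by
    filter_upwards [lt_mem_nhds (show (-1 : ℝ) < 0 by norm_num)] with s hs
    rw [← hf (1 + s) x (by linarith), add_smul, one_smul]
  have := h.unique ((hasDerivAt_const 0 (f x)).congr_of_eventuallyEq hc)
  simpa using this

/-- Differentiating Euler's relation `∂ₓ f(x) = 0` gives the mixed second derivatives of a radially
constant function that involve the radial direction. -/
theorem IsRadial.dirDeriv_dirDeriv_self {f : E3 → ℝ} (hf : IsRadial f) {V : Set E3}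
    (hV : IsOpen V) (hfV : ContDiffOn ℝ ∞ f V) {x : E3} (hx : x ∈ V) (v : E3) :
    dirDeriv v (dirDeriv x f) x = -dirDeriv v f x := by
  have hx0 : x + (0 : ℝ) • v ∈ V := by simpa using hx
  have h1 := (hfV.dirDeriv hV x).hasDerivAt_line hV hx0
  have h2 := (hasDerivAt_id (0 : ℝ)).mul ((hfV.dirDeriv hV v).hasDerivAt_line hV hx0)
  have hc : (fun s : ℝ => dirDeriv x f (x + s • v) + id s * dirDeriv v f (x + s • v))
      =ᶠ[𝓝 0] fun _ => 0 := by
    filter_upwards [hV.eventually_line_mem hx v] with s hs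
    have := hf.dirDeriv_self hV hfV hs
    simpa [dirDeriv] using this
  have := (h1.add h2).unique ((hasDerivAt_const 0 (0 : ℝ)).congr_of_eventuallyEq hc)
  simp at this
  linarith

/-! ### The equation on cones -/

theorem line_norm_sq {x v : E3} (hx : ‖x‖ = 1) (hv : ‖v‖ = 1) (t : ℝ) :
    ‖x + t • v‖ ^ 2 = 1 + 2 * inner ℝ x v * t + t ^ 2 := by
  rw [norm_add_sq_real, norm_smul, hx, hv, inner_smul_right, Real.norm_eq_abs, mul_one, sq_abs]
  ring

theorem exists_orthonormalBasis_of_orthonormal_pair {e u : E3} (he : ‖e‖ = 1) (hu : ‖u‖ = 1)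
    (heu : inner ℝ e u = 0) : ∃ b : OrthonormalBasis (Fin 3) ℝ E3, b 0 = e ∧ b 1 = u := by
  have hcard : Module.finrank ℝ E3 = Fintype.card (Fin 3) := by simp
  have hv : Orthonormal ℝ (({0, 1} : Set (Fin 3)).domRestrict ![e, u, 0]) := by
    constructor
    · rintro ⟨i, rfl | rfl⟩ <;> simpa
    · rintro ⟨i, rfl | rfl⟩ ⟨j, rfl | rfl⟩ hij <;> simp_all [real_inner_comm]
  obtain ⟨b, hb⟩ := hv.exists_orthonormalBasis_extension_of_card_eq hcard
  exact ⟨b, by simpa using hb 0 (by simp), by simpa using hb 1 (by simp)⟩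

/-- A smooth positive radially constant function on an open set of `ℝ³` whose restriction to the
unit sphere satisfies `ρ Δρ + ρ² / 2 = 3 / 2 (|∇ρ|² - 1)`. The powers of `‖x‖` make the equation
invariant under dilations. -/
structure IsConeSolution (V : Set E3) (f : E3 → ℝ) : Prop where
  isOpen : IsOpen V
  smooth : ContDiffOn ℝ ∞ f V
  radial : IsRadial f
  pos : ∀ x ∈ V, 0 < f x
  pde : ∀ x ∈ V, ‖x‖ ^ 2 * (f x * (Δ f) x) + f x ^ 2 / 2
    = 3 / 2 * (‖x‖ ^ 2 * ‖gradient f x‖ ^ 2 - 1)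

/-- The equation differentiated at a point `e` of the unit sphere in a tangential direction `u`. -/
theorem IsConeSolution.pde_deriv {V : Set E3} {f : E3 → ℝ} (h : IsConeSolution V f) {e u : E3}
    (he : e ∈ V) (hne : ‖e‖ = 1) (hu : ‖u‖ = 1) (heu : inner ℝ e u = 0)
    (b : OrthonormalBasis (Fin 3) ℝ E3) :
    dirDeriv u f e * (∑ k, dirDeriv (b k) (dirDeriv (b k) f) e)
      + f e * (∑ k, dirDeriv u (dirDeriv (b k) (dirDeriv (b k) f)) e) + f e * dirDeriv u f e
      = 3 * ∑ k, dirDeriv (b k) f e * dirDeriv u (dirDeriv (b k) f) e := by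
  have he0 : e + (0 : ℝ) • u ∈ V := by simpa using he
  have hV := h.isOpen
  have hf := h.smooth
  have d0 := hf.hasDerivAt_line hV he0
  have d1 := fun k => (hf.dirDeriv hV (b k)).hasDerivAt_line hV he0
  have d2 := fun k => ((hf.dirDeriv hV (b k)).dirDeriv hV (b k)).hasDerivAt_line hV he0
  have dsq : HasDerivAt (fun t : ℝ => 1 + t ^ 2) 0 0 := by
    simpa using ((hasDerivAt_id (0 : ℝ)).pow 2).const_add 1
  have L := (dsq.mul (d0.mul (HasDerivAt.fun_sum fun k (_ : k ∈ Finset.univ) => d2 k))).add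
    ((d0.pow 2).div_const 2)
  have R := ((dsq.mul (HasDerivAt.fun_sum fun k (_ : k ∈ Finset.univ) =>
    (d1 k).pow 2)).sub_const 1).const_mul (3 / 2)
  have key := L.unique (R.congr_of_eventuallyEq ?_)
  · simp only [zero_smul, add_zero, Fin.sum_univ_three, Pi.pow_apply] at key ⊢
    norm_num at key
    linarith
  · filter_upwards [hV.eventually_line_mem he u] with t ht
    have := h.pde _ ht
    rw [line_norm_sq hne hu, heu, laplacian_eq_sum_dirDeriv hf hV ht b,
      norm_gradient_sq _ _ b] at this
    simp only [Pi.add_apply, Pi.mul_apply, Pi.pow_apply] at this ⊢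
    linarith

/-- The first and second derivatives, along an orthonormal direction, of the function
`|∇ρ|² + a ρ² + ε log ρ` (extended to be radially constant) at a local maximum. -/
theorem IsConeSolution.deriv_test {V : Set E3} {f : E3 → ℝ} (h : IsConeSolution V f) {e u : E3}
    (he : e ∈ V) (hne : ‖e‖ = 1) (hu : ‖u‖ = 1) {a ε : ℝ}
    (hmax : IsLocalMax (fun x => ‖x‖ ^ 2 * ‖gradient f x‖ ^ 2 + a * f x ^ 2 + ε * Real.log (f x)) e)
    (b : OrthonormalBasis (Fin 3) ℝ E3) :
    2 * inner ℝ e u * ∑ i, dirDeriv (b i) f e ^ 2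
        + 2 * ∑ i, dirDeriv (b i) f e * dirDeriv u (dirDeriv (b i) f) e
        + 2 * a * f e * dirDeriv u f e + ε * (dirDeriv u f e / f e) = 0 ∧
    2 * ∑ i, dirDeriv (b i) f e ^ 2
        + 8 * inner ℝ e u * ∑ i, dirDeriv (b i) f e * dirDeriv u (dirDeriv (b i) f) e
        + 2 * ∑ i, (dirDeriv u (dirDeriv (b i) f) e ^ 2
          + dirDeriv (b i) f e * dirDeriv u (dirDeriv u (dirDeriv (b i) f)) e)
        + 2 * a * (dirDeriv u f e ^ 2 + f e * dirDeriv u (dirDeriv u f) e)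
        + ε * (dirDeriv u (dirDeriv u f) e / f e - dirDeriv u f e ^ 2 / f e ^ 2) ≤ 0 := by
  have hV := h.isOpen
  have hf := h.smooth
  have he0 : e + (0 : ℝ) • u ∈ V := by simpa using he
  set c : ℝ := inner ℝ e u with hc
  have dF : ∀ t : ℝ, e + t • u ∈ V → HasDerivAt (fun s : ℝ => f (e + s • u))
      (dirDeriv u f (e + t • u)) t := fun t ht => hf.hasDerivAt_line hV ht
  have dF1 : ∀ t : ℝ, e + t • u ∈ V → HasDerivAt (fun s : ℝ => dirDeriv u f (e + s • u))
      (dirDeriv u (dirDeriv u f) (e + t • u)) t :=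
    fun t ht => (hf.dirDeriv hV u).hasDerivAt_line hV ht
  have dG : ∀ i, ∀ t : ℝ, e + t • u ∈ V → HasDerivAt (fun s : ℝ => dirDeriv (b i) f (e + s • u))
      (dirDeriv u (dirDeriv (b i) f) (e + t • u)) t :=
    fun i t ht => (hf.dirDeriv hV (b i)).hasDerivAt_line hV ht
  have dG1 : ∀ i, ∀ t : ℝ, e + t • u ∈ V → HasDerivAt
      (fun s : ℝ => dirDeriv u (dirDeriv (b i) f) (e + s • u))
      (dirDeriv u (dirDeriv u (dirDeriv (b i) f)) (e + t • u)) t :=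
    fun i t ht => ((hf.dirDeriv hV (b i)).dirDeriv hV u).hasDerivAt_line hV ht
  have dsq : ∀ t : ℝ, HasDerivAt (fun s : ℝ => 1 + 2 * c * s + s ^ 2) (2 * c + 2 * t) t := by
    intro t
    exact ((((hasDerivAt_id' t).const_mul (2 * c)).const_add 1).add
      ((hasDerivAt_id' t).pow 2)).congr_deriv (by simp)
  have dlin : ∀ t : ℝ, HasDerivAt (fun s : ℝ => 2 * c + 2 * s) 2 t := by
    intro t
    simpa using ((hasDerivAt_id t).const_mul 2).const_add (2 * c)
  have dS : ∀ t : ℝ, e + t • u ∈ V →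
      HasDerivAt (fun s : ℝ => ∑ i, dirDeriv (b i) f (e + s • u) ^ 2)
      (2 * ∑ i, dirDeriv (b i) f (e + t • u) * dirDeriv u (dirDeriv (b i) f) (e + t • u)) t := by
    intro t ht
    refine (HasDerivAt.fun_sum fun i (_ : i ∈ Finset.univ) => (dG i t ht).pow 2).congr_deriv ?_
    simp only [Finset.mul_sum, Nat.cast_ofNat, Nat.add_one_sub_one, pow_one, mul_assoc]
  have dS1 : HasDerivAt (fun s : ℝ => 2 * ∑ i,
        dirDeriv (b i) f (e + s • u) * dirDeriv u (dirDeriv (b i) f) (e + s • u))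
      (2 * ∑ i, (dirDeriv u (dirDeriv (b i) f) (e + (0 : ℝ) • u) ^ 2
          + dirDeriv (b i) f (e + (0 : ℝ) • u)
            * dirDeriv u (dirDeriv u (dirDeriv (b i) f)) (e + (0 : ℝ) • u))) 0 := by
    refine (((HasDerivAt.fun_sum fun i (_ : i ∈ Finset.univ) =>
      (dG i 0 he0).mul (dG1 i 0 he0)).const_mul 2)).congr_deriv ?_
    simp only [sq]
  have hline : IsLocalMax (fun t : ℝ => (1 + 2 * c * t + t ^ 2)
      * (∑ i, dirDeriv (b i) f (e + t • u) ^ 2) + a * f (e + t • u) ^ 2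
      + ε * Real.log (f (e + t • u))) 0 := by
    have hcont : Tendsto (fun t : ℝ => e + t • u) (𝓝 0) (𝓝 e) := by
      have : ContinuousAt (fun t : ℝ => e + t • u) 0 := by fun_prop
      simpa [ContinuousAt] using this
    have := hcont.eventually hmax
    refine this.mono fun t ht => ?_
    simp only [norm_gradient_sq _ _ b, line_norm_sq hne hu] at ht
    simpa [hne] using ht
  have main := hline.first_second_deriv
    (q₁ := fun t => (2 * c + 2 * t) * (∑ i, dirDeriv (b i) f (e + t • u) ^ 2)
      + (1 + 2 * c * t + t ^ 2) * (2 * ∑ i, dirDeriv (b i) f (e + t • u)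
        * dirDeriv u (dirDeriv (b i) f) (e + t • u))
      + a * (2 * (f (e + t • u) * dirDeriv u f (e + t • u)))
      + ε * (dirDeriv u f (e + t • u) / f (e + t • u))) ?_
    (((((dlin 0).mul (dS 0 he0)).add ((dsq 0).mul dS1)).add
      ((((dF 0 he0).mul (dF1 0 he0)).const_mul 2).const_mul a)).add
      (((dF1 0 he0).div (dF 0 he0) (h.pos _ he0).ne').const_mul ε))
  · have hfe : f e ≠ 0 := (h.pos _ he).ne'
    simp only [zero_smul, add_zero, mul_zero] at main
    refine ⟨by linarith [main.1], le_trans (le_of_eq ?_) main.2⟩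
    field_simp
    ring
  · filter_upwards [hV.eventually_line_mem he u] with t ht
    refine ((((dsq t).mul (dS t ht)).add (((dF t ht).pow 2).const_mul a)).add
      (((dF t ht).log (h.pos _ ht).ne').const_mul ε)).congr_deriv ?_
    simp only [Nat.cast_ofNat, Nat.add_one_sub_one, pow_one]
    ring

/-! ### The Laplacian at an interior maximum -/

/-- The pointwise inequality behind the gradient bound: at a local maximum of
`|∇ρ|² + a ρ² + ε log ρ` that is not a critical point of `ρ`, the vanishing of the first derivatives
makes `∇ρ` an eigenvector of the Hessian of `ρ` with known eigenvalue, and then the sign of the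
Laplacian factors. -/
theorem IsConeSolution.factor_mul_factor_le {V : Set E3} {f : E3 → ℝ} (h : IsConeSolution V f)
    {e : E3} (he : e ∈ V) (hne : ‖e‖ = 1) {a ε : ℝ}
    (hmax : IsLocalMax (fun x => ‖x‖ ^ 2 * ‖gradient f x‖ ^ 2 + a * f x ^ 2 + ε * Real.log (f x)) e)
    (hg : 0 < ‖gradient f e‖ ^ 2) :
    (3 / 2 * (‖gradient f e‖ ^ 2 - 1) + (2 * a - 1 / 2) * f e ^ 2 + ε)
      * (1 / 2 * (‖gradient f e‖ ^ 2 - 3) + (a - 1 / 2) * f e ^ 2 + ε / 2)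
      ≤ ε * ‖gradient f e‖ ^ 2 := by
  have hV := h.isOpen
  have hf := h.smooth
  have hγ : 0 < ‖gradient f e‖ := by simpa [sq_pos_iff] using hg
  set γ := ‖gradient f e‖ with hγdef
  -- The orthonormal frame `e`, `∇f / |∇f|` and a third vector.
  set u : E3 := γ⁻¹ • gradient f e with hu
  have hnu : ‖u‖ = 1 := by
    rw [hu, norm_smul, norm_inv, norm_norm, ← hγdef, inv_mul_cancel₀ hγ.ne']
  have heu : inner ℝ e u = 0 := by
    rw [hu, inner_smul_right, real_inner_comm, inner_gradient, h.radial.dirDeriv_self hV hf he,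
      mul_zero]
  obtain ⟨b, hb0, hb1⟩ := exists_orthonormalBasis_of_orthonormal_pair hne hnu heu
  have hgrad : gradient f e = γ • b 1 := by rw [hb1, hu, smul_inv_smul₀ hγ.ne']
  have hfi : ∀ i, dirDeriv (b i) f e = if i = 1 then γ else 0 := by
    intro i
    rw [← inner_gradient, hgrad, inner_smul_left, b.inner_eq_ite]
    by_cases hi : i = 1 <;> simp [hi, eq_comm]
  have hf0 : dirDeriv (b 0) f e = 0 := by simp [hfi]
  have hf1 : dirDeriv (b 1) f e = γ := by simp [hfi]
  have hf2 : dirDeriv (b 2) f e = 0 := by simp [hfi]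
  have hrad : ∀ v, dirDeriv v (dirDeriv (b 0) f) e = -dirDeriv v f e := by
    intro v
    rw [hb0]
    exact h.radial.dirDeriv_dirDeriv_self hV hf he v
  have hcomm : ∀ v w, dirDeriv v (dirDeriv w f) e = dirDeriv w (dirDeriv v f) e :=
    fun v w => dirDeriv_comm hf hV he v w
  have h00 : dirDeriv (b 0) (dirDeriv (b 0) f) e = 0 := by rw [hrad, hf0, neg_zero]
  have h10 : dirDeriv (b 1) (dirDeriv (b 0) f) e = -γ := by rw [hrad, hf1]
  have h20 : dirDeriv (b 2) (dirDeriv (b 0) f) e = 0 := by rw [hrad, hf2, neg_zero]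
  have h01 : dirDeriv (b 0) (dirDeriv (b 1) f) e = -γ := by rw [hcomm, h10]
  have h02 : dirDeriv (b 0) (dirDeriv (b 2) f) e = 0 := by rw [hcomm, h20]
  have h21c := hcomm (b 2) (b 1)
  -- Third derivatives only enter through the derivative of `Δf` along `b 1`.
  have hthird : ∀ k, dirDeriv (b k) (dirDeriv (b k) (dirDeriv (b 1) f)) e
      = dirDeriv (b 1) (dirDeriv (b k) (dirDeriv (b k) f)) e := by
    intro k
    rw [dirDeriv_congr hV (fun y hy => dirDeriv_comm hf hV hy (b k) (b 1)) he,
      dirDeriv_comm (hf.dirDeriv hV (b k)) hV he]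
  have hpd := h.pde_deriv he hne (u := b 1) (by simp) (by rw [hb1, heu]) b
  have hpde := h.pde e he
  rw [laplacian_eq_sum_dirDeriv hf hV he b, hne, ← hγdef] at hpde
  have t0 := h.deriv_test he hne (u := b 0) (by simp) hmax b
  have t1 := h.deriv_test he hne (u := b 1) (by simp) hmax b
  have t2 := h.deriv_test he hne (u := b 2) (by simp) hmax b
  have i0 : inner ℝ e (b 0) = 1 := by rw [hb0, real_inner_self_eq_norm_sq, hne, one_pow]
  have i1 : inner ℝ e (b 1) = 0 := by rw [hb1, heu]
  have i2 : inner ℝ e (b 2) = 0 := by rw [← hb0, b.inner_eq_ite]; simp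
  simp only [Fin.sum_univ_three, hf0, hf1, hf2, h00, h10, h20, h01, h02, h21c, i0, i1, i2, hthird]
    at hpd hpde t0 t1 t2
  have hfe := h.pos e he
  set F := f e
  set p := dirDeriv (b 1) (dirDeriv (b 1) f) e
  set q := dirDeriv (b 1) (dirDeriv (b 2) f) e
  set r := dirDeriv (b 2) (dirDeriv (b 2) f) e
  set T0 := dirDeriv (b 1) (dirDeriv (b 0) (dirDeriv (b 0) f)) e
  set T1 := dirDeriv (b 1) (dirDeriv (b 1) (dirDeriv (b 1) f)) e
  set T2 := dirDeriv (b 1) (dirDeriv (b 2) (dirDeriv (b 2) f)) e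
  have hq : q = 0 := by
    have : 2 * γ * q = 0 := by linarith [t2.1]
    simpa [hγ.ne'] using this
  have hp : p * F = -(a * F ^ 2 + ε / 2) := by
    have h1 : (2 * γ) * (p * F + (a * F ^ 2 + ε / 2)) = 0 := by
      have := congrArg (· * F) t1.1
      simp only [zero_mul] at this
      field_simp at this
      linarith
    have : p * F + (a * F ^ 2 + ε / 2) = 0 := by simpa [hγ.ne'] using h1
    linarith
  have hX : (p + r) * F = 3 / 2 * (γ ^ 2 - 1) - F ^ 2 / 2 := by linarith
  have hT : F * (T0 + T1 + T2) = 3 * γ * p - γ * (p + r) - F * γ := by linarith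
  rw [hq] at t1 t2
  have hsum := add_nonpos (add_nonpos t0.2 t1.2) t2.2
  have hsum' : (γ ^ 2 + p ^ 2 + r ^ 2 + γ * (T0 + T1 + T2)
      + a * (γ ^ 2 + F * (p + r))) * F ^ 2
      + ε / 2 * ((p + r) * F - γ ^ 2) ≤ 0 := by
    have := mul_nonpos_of_nonpos_of_nonneg hsum (sq_nonneg F)
    field_simp at this
    linarith
  have e1 : γ * (T0 + T1 + T2) * F ^ 2 = γ * F * (3 * γ * p - γ * (p + r) - F * γ) := by
    rw [← hT]; ring
  have hr : r * F = 3 / 2 * (γ ^ 2 - 1) - F ^ 2 / 2 + (a * F ^ 2 + ε / 2) := by linarith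
  have e2 : (γ ^ 2 + p ^ 2 + r ^ 2 + γ * (T0 + T1 + T2)
      + a * (γ ^ 2 + F * (p + r))) * F ^ 2 + ε / 2 * ((p + r) * F - γ ^ 2)
      = γ ^ 2 * F ^ 2 + (p * F) ^ 2 + (r * F) ^ 2 + γ ^ 2 * (2 * (p * F) - r * F) - F ^ 2 * γ ^ 2
        + a * F ^ 2 * (γ ^ 2 + (p * F + r * F)) + ε / 2 * (p * F + r * F - γ ^ 2) := by
    linear_combination e1
  rw [e2, hp, hr] at hsum'
  linarith

/-! ### The barrier -/

/-- The barrier as a function of the cosine `c` of the distance to the point where it is largest.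
In terms of `y = √((1 + c) / 2)`, the cosine of half that distance, it is
`2√3 y + (√6 - √3) y²`. -/
noncomputable def barrier (c : ℝ) : ℝ :=
  2 * √3 * √((1 + c) / 2) + (√6 - √3) * √((1 + c) / 2) ^ 2

theorem sqrt_three_lt_sqrt_six : √3 < √6 := Real.sqrt_lt_sqrt (by norm_num) (by norm_num)

theorem barrier_pos {c : ℝ} (hc : -1 < c) : 0 < barrier c := by
  have hy : 0 < √((1 + c) / 2) := Real.sqrt_pos.2 (by linarith)
  have h3 : 0 < √(3 : ℝ) := by positivity
  have := sub_pos.2 sqrt_three_lt_sqrt_six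
  unfold barrier
  positivity

theorem barrier_lt {c : ℝ} (hc : c ≤ 1) : barrier c < 4.2 := by
  have hy0 := Real.sqrt_nonneg ((1 + c) / 2)
  have hy : √((1 + c) / 2) ≤ 1 := Real.sqrt_le_one.2 (by linarith)
  have h36 := sub_pos.2 sqrt_three_lt_sqrt_six
  have h3 : √(3 : ℝ) < 1.74 := (Real.sqrt_lt' (by norm_num)).2 (by norm_num)
  have h6 : √(6 : ℝ) < 2.45 := (Real.sqrt_lt' (by norm_num)).2 (by norm_num)
  have hs : √((1 + c) / 2) ^ 2 ≤ 1 := pow_le_one₀ hy0 hy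
  have e1 := mul_le_mul_of_nonneg_left hy (by positivity : 0 ≤ 2 * √(3 : ℝ))
  have e2 := mul_le_mul_of_nonneg_left hs h36.le
  unfold barrier
  linarith

theorem continuous_barrier : Continuous barrier := by
  unfold barrier
  fun_prop

/-- First and second order contact, along a tangential direction `u`, of a radially constant
function with a multiple of the barrier that touches it from above. Here `y` is the cosine of half
the distance between `e` and `n`. -/
theorem barrier_contact {V : Set E3} {f : E3 → ℝ} (hV : IsOpen V) (hf : ContDiffOn ℝ ∞ f V)
    {e u n : E3} {k y : ℝ} (he : e ∈ V) (hne : ‖e‖ = 1) (hu : ‖u‖ = 1) (heu : inner ℝ e u = 0)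
    (hen : -1 < inner ℝ e n) (hy : y = √((1 + inner ℝ e n) / 2))
    (hmax : IsLocalMax (fun x => f x - k * barrier (inner ℝ x n / ‖x‖)) e) :
    dirDeriv u f e = k * (2 * √3 + 2 * (√6 - √3) * y) * (inner ℝ u n / (4 * y)) ∧
    dirDeriv u (dirDeriv u f) e ≤ k * ((2 * √3 + 2 * (√6 - √3) * y)
        * (-inner ℝ e n / (4 * y) - inner ℝ u n ^ 2 / (16 * y ^ 3))
      + 2 * (√6 - √3) * (inner ℝ u n / (4 * y)) ^ 2) := by
  have he0 : e + (0 : ℝ) • u ∈ V := by simpa using he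
  set c : ℝ := inner ℝ e n with hc
  set m : ℝ := inner ℝ u n with hm
  set a : ℝ := 2 * √3 with ha
  set b : ℝ := √6 - √3 with hb
  have hy0 : 0 < y := hy ▸ Real.sqrt_pos.2 (by linarith)
  set R : ℝ → ℝ := fun t => (√(1 + t ^ 2))⁻¹ with hR
  set C : ℝ → ℝ := fun t => (c + t * m) * R t with hC
  set C₁ : ℝ → ℝ := fun t => m * R t + (c + t * m) * (-t * R t ^ 3) with hC₁
  set Y : ℝ → ℝ := fun t => √((1 + C t) / 2) with hY
  have hR0 : R 0 = 1 := by simp [hR]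
  have hC0 : C 0 = c := by simp [hC, hR0]
  have hC₁0 : C₁ 0 = m := by simp [hC₁, hR0]
  have hY0 : Y 0 = y := by simp [hY, hC0, hy]
  have dR : ∀ t, HasDerivAt R (-t * R t ^ 3) t := by
    intro t
    have hpos : (0 : ℝ) < 1 + t ^ 2 := by positivity
    have hs : √(1 + t ^ 2) ≠ 0 := (Real.sqrt_pos.2 hpos).ne'
    refine (((((hasDerivAt_id' t).pow 2).const_add 1).sqrt hpos.ne').inv hs).congr_deriv ?_
    simp only [hR]
    norm_num
    field_simp
  have dlin : ∀ t, HasDerivAt (fun t => c + t * m) m t := by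
    intro t
    simpa using ((hasDerivAt_id' t).mul_const m).const_add c
  have dC : ∀ t, HasDerivAt C (C₁ t) t := fun t => (dlin t).mul (dR t)
  have dC₁ : HasDerivAt C₁ (-c) 0 := by
    refine (((dR 0).const_mul m).add ((dlin 0).mul
      ((hasDerivAt_id' 0).neg.mul ((dR 0).pow 3)))).congr_deriv ?_
    simp [hR0]
  have hev : ∀ᶠ t in 𝓝 (0 : ℝ), 0 < (1 + C t) / 2 := by
    refine (((dC 0).continuousAt.const_add 1).div_const 2).eventually (lt_mem_nhds ?_)
    simp only [hC0]
    linarith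
  have dY : ∀ᶠ t in 𝓝 (0 : ℝ), HasDerivAt Y (C₁ t / (4 * Y t)) t := by
    filter_upwards [hev] with t ht
    refine ((((dC t).const_add 1).div_const 2).sqrt ht.ne').congr_deriv ?_
    have : √((1 + C t) / 2) ≠ 0 := (Real.sqrt_pos.2 ht).ne'
    simp only [hY]
    field_simp
    norm_num
  have dY0 : HasDerivAt Y (m / (4 * y)) 0 := by
    have := dY.self_of_nhds
    rwa [hC₁0, hY0] at this
  have dY₁ : HasDerivAt (fun t => C₁ t / (4 * Y t)) (-c / (4 * y) - m ^ 2 / (16 * y ^ 3)) 0 := by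
    refine (dC₁.div (dY0.const_mul 4) (by rw [hY0]; positivity)).congr_deriv ?_
    rw [hY0, hC₁0]
    field_simp
    ring
  have hline : IsLocalMax (fun t : ℝ => f (e + t • u) - k * (a * Y t + b * Y t ^ 2)) 0 := by
    have hcont : Tendsto (fun t : ℝ => e + t • u) (𝓝 0) (𝓝 e) := by
      have : ContinuousAt (fun t : ℝ => e + t • u) 0 := by fun_prop
      simpa [ContinuousAt] using this
    have hB : ∀ t : ℝ, barrier (inner ℝ (e + t • u) n / ‖e + t • u‖)
        = a * Y t + b * Y t ^ 2 := by
      intro t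
      have h1 : ‖e + t • u‖ = √(1 + t ^ 2) := by
        rw [← Real.sqrt_sq (norm_nonneg (e + t • u)), line_norm_sq hne hu, heu]
        simp
      rw [h1, inner_add_left, inner_smul_left, div_eq_mul_inv]
      rfl
    refine (hcont.eventually hmax).mono fun t ht => ?_
    have h0 := hB 0
    simp only [zero_smul, add_zero] at h0
    simp only [hB, h0] at ht
    simpa using ht
  have main := hline.first_second_deriv
    (q₁ := fun t => dirDeriv u f (e + t • u) - k * (a * (C₁ t / (4 * Y t))
      + b * (2 * (Y t * (C₁ t / (4 * Y t)))))) ?_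
    (((hf.dirDeriv hV u).hasDerivAt_line hV he0).sub
      (((dY₁.const_mul a).add (((dY0.mul dY₁).const_mul 2).const_mul b)).const_mul k))
  · simp only [zero_smul, add_zero, hY0, hC₁0] at main
    exact ⟨by linarith [main.1], by linarith [main.2]⟩
  · filter_upwards [hV.eventually_line_mem he u, dY] with t ht hYt
    refine ((hf.hasDerivAt_line hV ht).sub
      (((hYt.const_mul a).add ((hYt.pow 2).const_mul b)).const_mul k)).congr_deriv ?_
    simp only [Nat.cast_ofNat, Nat.add_one_sub_one, pow_one]
    ring

/-- The barrier satisfies the equation with an inequality sign, the defect being a multiple of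
`y (1 - y) ^ 2`. Hence no multiple of it by a factor greater than `1` can touch a solution
from above. -/
theorem IsConeSolution.le_one_of_contact {V : Set E3} {f : E3 → ℝ} (h : IsConeSolution V f)
    {e n : E3} {k : ℝ} (he : e ∈ V) (hne : ‖e‖ = 1) (hn : ‖n‖ = 1) (hen : -1 < inner ℝ e n)
    (hk : f e = k * barrier (inner ℝ e n))
    (hmax : IsLocalMax (fun x => f x - k * barrier (inner ℝ x n / ‖x‖)) e) : k ≤ 1 := by
  have hV := h.isOpen
  have hf := h.smooth
  obtain ⟨b, hb⟩ := Orthonormal.exists_orthonormalBasis_extension_of_card_eq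
    (v := fun _ : Fin 3 => e) (s := {0}) (𝕜 := ℝ) (by simp) (by
      constructor
      · rintro ⟨i, rfl⟩
        simpa
      · rintro ⟨i, rfl⟩ ⟨j, rfl⟩ hij
        exact absurd rfl hij)
  have hb0 : b 0 = e := hb 0 rfl
  have i1 : inner ℝ e (b 1) = 0 := by rw [← hb0, b.inner_eq_ite]; simp
  have i2 : inner ℝ e (b 2) = 0 := by rw [← hb0, b.inner_eq_ite]; simp
  have hf0 : dirDeriv (b 0) f e = 0 := by
    rw [hb0]
    exact h.radial.dirDeriv_self hV hf he
  have h00 : dirDeriv (b 0) (dirDeriv (b 0) f) e = 0 := by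
    rw [hb0, h.radial.dirDeriv_dirDeriv_self hV hf he,
      h.radial.dirDeriv_self hV hf he, neg_zero]
  set y := √((1 + inner ℝ e n) / 2) with hy
  have hy0 : 0 < y := Real.sqrt_pos.2 (by linarith)
  obtain ⟨p1, p2⟩ := barrier_contact hV hf he hne (by simp) i1 hen hy hmax
  obtain ⟨q1, q2⟩ := barrier_contact hV hf he hne (by simp) i2 hen hy hmax
  have hsum : inner ℝ (b 1) n ^ 2 + inner ℝ (b 2) n ^ 2 = 1 - inner ℝ e n ^ 2 := by
    have := b.sum_sq_norm_inner_right n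
    rw [Fin.sum_univ_three, hb0, hn] at this
    simp only [Real.norm_eq_abs, sq_abs] at this
    linarith
  have hpde := h.pde e he
  rw [laplacian_eq_sum_dirDeriv hf hV he b, norm_gradient_sq _ _ b, hne] at hpde
  simp only [Fin.sum_univ_three, hf0, h00] at hpde
  have hc : inner ℝ e n = 2 * y ^ 2 - 1 := by
    rw [hy, Real.sq_sqrt (by linarith)]
    ring
  have hBpos := barrier_pos hen
  have hB : barrier (inner ℝ e n) = 2 * √3 * y + (√6 - √3) * y ^ 2 := rfl
  have hfe := h.pos e he
  have hkpos : 0 < k := by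
    rw [hk] at hfe
    exact (pos_iff_pos_of_mul_pos hfe).2 hBpos
  rw [hB] at hk
  have h3 : √(3 : ℝ) ^ 2 = 3 := Real.sq_sqrt (by norm_num)
  have h6 : √(6 : ℝ) ^ 2 = 6 := Real.sq_sqrt (by norm_num)
  have ha2 : (2 * √(3 : ℝ)) ^ 2 = 12 := by rw [mul_pow, h3]; norm_num
  have hb2 : (√(6 : ℝ) - √3) ^ 2 + 2 * √3 * (√6 - √3) = 3 := by linear_combination h6 - h3
  have hab : 0 < 2 * √(3 : ℝ) * (√6 - √3) :=
    mul_pos (by positivity) (sub_pos.2 sqrt_three_lt_sqrt_six)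
  set a : ℝ := 2 * √3
  set β : ℝ := √6 - √3
  set m1 : ℝ := inner ℝ (b 1) n
  set m2 : ℝ := inner ℝ (b 2) n
  rw [hc] at hsum p2 q2
  have hG : dirDeriv (b 1) f e ^ 2 + dirDeriv (b 2) f e ^ 2
      = k ^ 2 * ((a + 2 * β * y) ^ 2 * (1 - y ^ 2) / 4) := by
    rw [p1, q1]
    have : (k * (a + 2 * β * y) * (m1 / (4 * y))) ^ 2 + (k * (a + 2 * β * y) * (m2 / (4 * y))) ^ 2
        = k ^ 2 * (a + 2 * β * y) ^ 2 * (m1 ^ 2 + m2 ^ 2) / (16 * y ^ 2) := by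
      field_simp
      ring
    rw [this, hsum]
    field_simp
    ring
  have hL : dirDeriv (b 1) (dirDeriv (b 1) f) e + dirDeriv (b 2) (dirDeriv (b 2) f) e
      ≤ k * ((a + 2 * β * y) * (1 - 3 * y ^ 2) / (4 * y) + β * (1 - y ^ 2) / 2) := by
    refine (add_le_add p2 q2).trans (le_of_eq ?_)
    have : k * ((a + 2 * β * y) * (-(2 * y ^ 2 - 1) / (4 * y) - m1 ^ 2 / (16 * y ^ 3))
          + 2 * β * (m1 / (4 * y)) ^ 2)
        + k * ((a + 2 * β * y) * (-(2 * y ^ 2 - 1) / (4 * y) - m2 ^ 2 / (16 * y ^ 3))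
          + 2 * β * (m2 / (4 * y)) ^ 2)
        = k * ((a + 2 * β * y) * (-(2 * y ^ 2 - 1) / (2 * y) - (m1 ^ 2 + m2 ^ 2) / (16 * y ^ 3))
          + 2 * β * (m1 ^ 2 + m2 ^ 2) / (16 * y ^ 2)) := by
      field_simp
      ring
    rw [this, hsum]
    field_simp
    ring
  have hmul := mul_le_mul_of_nonneg_left hL hfe.le
  have hfinal : k ^ 2 * (3 / 2 + a * β / 4 * (y * (1 - y) ^ 2)) ≤ 3 / 2 := by
    have e1 : k * (a * y + β * y ^ 2) * (k * ((a + 2 * β * y) * (1 - 3 * y ^ 2) / (4 * y)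
        + β * (1 - y ^ 2) / 2)) = k ^ 2 * ((a + β * y) * ((a + 2 * β * y) * (1 - 3 * y ^ 2) / 4
        + y * β * (1 - y ^ 2) / 2)) := by
      field_simp
    have e2 : (a + β * y) * ((a + 2 * β * y) * (1 - 3 * y ^ 2) / 4 + y * β * (1 - y ^ 2) / 2)
        + (a * y + β * y ^ 2) ^ 2 / 2 - 3 / 2 * ((a + 2 * β * y) ^ 2 * (1 - y ^ 2) / 4)
        = -(3 / 2 + a * β / 4 * (y * (1 - y) ^ 2)) := by
      linear_combination (-1 / 8 + y ^ 2 / 8) * ha2 - y ^ 2 / 2 * hb2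
    have e3 := congrArg (k ^ 2 * ·) e2
    rw [hk, e1, ← hk] at hmul
    have hsq : f e ^ 2 = k ^ 2 * (a * y + β * y ^ 2) ^ 2 := by rw [hk, mul_pow]
    linarith
  have hk2 : k ^ 2 ≤ 1 := by
    have : 0 ≤ k ^ 2 * (a * β / 4 * (y * (1 - y) ^ 2)) := by positivity
    linarith
  exact (sq_le_one_iff₀ hkpos.le).1 hk2

/-! ### Cones over subsets of the sphere -/

/-- `ℝ³ \ {0}` as an open submanifold of `ℝ³`. -/
def puncturedE3 : TopologicalSpace.Opens E3 := ⟨{0}ᶜ, isOpen_compl_singleton⟩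

theorem inv_norm_smul_mem_sphere (x : puncturedE3) :
    ‖(x : E3)‖⁻¹ • (x : E3) ∈ Metric.sphere (0 : E3) 1 := by
  have hx : (x : E3) ≠ 0 := x.2
  rw [mem_sphere_zero_iff_norm, norm_smul, norm_inv, norm_norm,
    inv_mul_cancel₀ (norm_ne_zero_iff.mpr hx)]

/-- The radial projection of `ℝ³ \ {0}` onto the unit sphere. -/
noncomputable def sphereProj : puncturedE3 → S2 :=
  Set.codRestrict (fun x : puncturedE3 => ‖(x : E3)‖⁻¹ • (x : E3)) _ inv_norm_smul_mem_sphere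

theorem coe_sphereProj (x : puncturedE3) : (sphereProj x : E3) = ‖(x : E3)‖⁻¹ • (x : E3) := rfl

theorem contMDiff_sphereProj : ContMDiff 𝓘(ℝ, E3) (𝓡 2) ∞ sphereProj := by
  have : Fact (Module.finrank ℝ E3 = 2 + 1) := ⟨by simp⟩
  refine ContMDiff.codRestrict_sphere (n := 2) (fun x => ?_) inv_norm_smul_mem_sphere
  have hx : (x : E3) ≠ 0 := x.2
  refine (contMDiffAt_subtype_iff (f := fun y : E3 => ‖y‖⁻¹ • y)).2 (ContDiffAt.contMDiffAt ?_)
  exact ((contDiffAt_norm ℝ hx).inv (norm_ne_zero_iff.2 hx)).smul contDiffAt_id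

theorem norm_smul_sphereProj (x : puncturedE3) : ‖(x : E3)‖ • (sphereProj x : E3) = x := by
  have hx : (x : E3) ≠ 0 := x.2
  rw [coe_sphereProj, smul_inv_smul₀ (norm_ne_zero_iff.2 hx)]

theorem radialExt_eq (f : S2 → ℝ) (x : puncturedE3) : radialExt f x = f (sphereProj x) := by
  have hx : (x : E3) ≠ 0 := x.2
  simp only [radialExt, dif_pos hx]
  rfl

theorem S2.norm_coe (θ : S2) : ‖(θ : E3)‖ = 1 := by simp

theorem S2.coe_ne_zero (θ : S2) : (θ : E3) ≠ 0 := by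
  rw [← norm_ne_zero_iff, S2.norm_coe]
  exact one_ne_zero

theorem sphereProj_smul (θ : S2) {s : ℝ} (hs : 0 < s) :
    sphereProj ⟨s • (θ : E3), smul_ne_zero hs.ne' θ.coe_ne_zero⟩ = θ := by
  ext1
  rw [coe_sphereProj]
  simp only [norm_smul, S2.norm_coe, Real.norm_eq_abs, abs_of_pos hs, mul_one]
  rw [inv_smul_smul₀ hs.ne']

theorem radialExt_smul_coe (f : S2 → ℝ) (θ : S2) {s : ℝ} (hs : 0 < s) :
    radialExt f (s • (θ : E3)) = f θ := by
  have := radialExt_eq f ⟨s • (θ : E3), smul_ne_zero hs.ne' θ.coe_ne_zero⟩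
  rwa [sphereProj_smul θ hs] at this

theorem radialExt_coe (f : S2 → ℝ) (θ : S2) : radialExt f (θ : E3) = f θ := by
  simpa using radialExt_smul_coe f θ one_pos

theorem isRadial_radialExt (f : S2 → ℝ) : IsRadial (radialExt f) := by
  intro s x hs
  by_cases hx : x = 0
  · rw [hx, smul_zero]
  · set y : puncturedE3 := ⟨x, hx⟩
    have hy : x = ‖x‖ • (sphereProj y : E3) := (norm_smul_sphereProj y).symm
    have hn : 0 < ‖x‖ := norm_pos_iff.2 hx
    rw [hy, smul_smul, radialExt_smul_coe f _ (mul_pos hs hn), radialExt_smul_coe f _ hn]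

/-- The open cone in `ℝ³` over a subset of the unit sphere, without its vertex. -/
def coneOver (D : Set S2) : Set E3 := Subtype.val '' (sphereProj ⁻¹' D)

theorem isOpen_coneOver {D : Set S2} (hD : IsOpen D) : IsOpen (coneOver D) :=
  puncturedE3.isOpen.isOpenMap_subtype_val _ (hD.preimage contMDiff_sphereProj.continuous)

theorem mem_coneOver {D : Set S2} {x : E3} :
    x ∈ coneOver D ↔ ∃ θ ∈ D, ∃ s : ℝ, 0 < s ∧ x = s • (θ : E3) := by
  constructor
  · rintro ⟨y, hy, rfl⟩
    exact ⟨sphereProj y, hy, ‖(y : E3)‖, norm_pos_iff.2 y.2, (norm_smul_sphereProj y).symm⟩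
  · rintro ⟨θ, hθ, s, hs, rfl⟩
    refine ⟨⟨s • (θ : E3), smul_ne_zero hs.ne' θ.coe_ne_zero⟩, ?_, rfl⟩
    rwa [Set.mem_preimage, sphereProj_smul θ hs]

theorem coe_mem_coneOver {D : Set S2} {θ : S2} (hθ : θ ∈ D) : (θ : E3) ∈ coneOver D :=
  mem_coneOver.2 ⟨θ, hθ, 1, one_pos, (one_smul _ _).symm⟩

theorem contDiffOn_radialExt {D : Set S2} (hD : IsOpen D) {f : S2 → ℝ}
    (hf : ContMDiffOn (𝓡 2) 𝓘(ℝ, ℝ) ∞ f D) : ContDiffOn ℝ ∞ (radialExt f) (coneOver D) := by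
  rintro _ ⟨y, hy, rfl⟩
  have h1 : ContMDiffAt (𝓡 2) 𝓘(ℝ, ℝ) ∞ f (sphereProj y) :=
    (hf _ hy).contMDiffAt (hD.mem_nhds hy)
  have h2 : ContMDiffAt 𝓘(ℝ, E3) 𝓘(ℝ, ℝ) ∞ (fun x : puncturedE3 => radialExt f x) y := by
    simp only [radialExt_eq]
    exact h1.comp y contMDiff_sphereProj.contMDiffAt
  exact (contMDiffAt_subtype_iff.1 h2).contDiffAt.contDiffWithinAt

theorem IsRadial.norm_gradient_sq_smul {f : E3 → ℝ} (hf : IsRadial f) {s : ℝ} (hs : 0 < s)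
    (x : E3) : s ^ 2 * ‖gradient f (s • x)‖ ^ 2 = ‖gradient f x‖ ^ 2 := by
  rw [norm_gradient_sq _ _ (EuclideanSpace.basisFun (Fin 3) ℝ),
    norm_gradient_sq _ _ (EuclideanSpace.basisFun (Fin 3) ℝ), Finset.mul_sum]
  refine Finset.sum_congr rfl fun i _ => ?_
  rw [hf.dirDeriv_smul hs]
  field_simp

theorem IsRadial.laplacian_smul {f : E3 → ℝ} (hf : IsRadial f) {V : Set E3} (hV : IsOpen V)
    (hfV : ContDiffOn ℝ ∞ f V) {s : ℝ} (hs : 0 < s) {x : E3} (hx : x ∈ V) (hsx : s • x ∈ V) :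
    s ^ 2 * (Δ f) (s • x) = (Δ f) x := by
  rw [laplacian_eq_sum_dirDeriv hfV hV hx (EuclideanSpace.basisFun (Fin 3) ℝ),
    laplacian_eq_sum_dirDeriv hfV hV hsx (EuclideanSpace.basisFun (Fin 3) ℝ), Finset.mul_sum]
  refine Finset.sum_congr rfl fun i _ => ?_
  rw [hf.dirDeriv_dirDeriv_smul hs]
  field_simp

theorem isConeSolution_radialExt {D : Set S2} (hD : IsOpen D) {ρ : S2 → ℝ}
    (hsmooth : ContMDiffOn (𝓡 2) 𝓘(ℝ, ℝ) ∞ ρ D) (hpos : ∀ θ ∈ D, 0 < ρ θ)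
    (heq : ∀ θ ∈ D, ρ θ * sphereLaplacian ρ θ + ρ θ ^ 2 / 2
      = 3 / 2 * (‖sphereGradient ρ θ‖ ^ 2 - 1)) :
    IsConeSolution (coneOver D) (radialExt ρ) where
  isOpen := isOpen_coneOver hD
  smooth := contDiffOn_radialExt hD hsmooth
  radial := isRadial_radialExt ρ
  pos := by
    intro x hx
    obtain ⟨θ, hθ, s, hs, rfl⟩ := mem_coneOver.1 hx
    rw [radialExt_smul_coe ρ θ hs]
    exact hpos θ hθ
  pde := by
    intro x hx
    obtain ⟨θ, hθ, s, hs, rfl⟩ := mem_coneOver.1 hx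
    have hL := (isRadial_radialExt ρ).laplacian_smul (isOpen_coneOver hD)
      (contDiffOn_radialExt hD hsmooth) hs (coe_mem_coneOver hθ) hx
    have hG := (isRadial_radialExt ρ).norm_gradient_sq_smul hs (θ : E3)
    have hn : ‖s • (θ : E3)‖ = s := by
      rw [norm_smul, S2.norm_coe, Real.norm_eq_abs, abs_of_pos hs, mul_one]
    rw [hn, hG, mul_left_comm, hL, radialExt_smul_coe ρ θ hs]
    exact heq θ hθ

/-- A Lipschitz function has bounded gradient. -/
theorem norm_sphereGradient_le {D : Set S2} (hD : IsOpen D) {ρ : S2 → ℝ} {K : NNReal}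
    (hlip : LipschitzOnWith K ρ D) {θ : S2} (hθ : θ ∈ D) : ‖sphereGradient ρ θ‖ ≤ 2 * K := by
  have h : ‖sphereGradient ρ θ‖ = ‖fderiv ℝ (radialExt ρ) (θ : E3)‖ := by
    simp [sphereGradient, gradient]
  rw [h]
  refine norm_fderiv_le_of_lip' ℝ (by positivity) ?_
  filter_upwards [(isOpen_coneOver hD).mem_nhds (coe_mem_coneOver hθ)] with x hx
  obtain ⟨η, hη, s, hs, rfl⟩ := mem_coneOver.1 hx
  rw [radialExt_smul_coe ρ η hs, radialExt_coe]
  have h1 := hlip.dist_le_mul η hη θ hθ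
  rw [Real.dist_eq] at h1
  rw [Real.norm_eq_abs]
  refine h1.trans ?_
  rw [mul_comm (2 : ℝ), mul_assoc]
  refine mul_le_mul_of_nonneg_left ?_ K.2
  rw [Subtype.dist_eq, dist_eq_norm]
  have e1 : ‖(η : E3) - s • (η : E3)‖ = |1 - s| := by
    rw [← one_smul ℝ (η : E3), smul_smul, mul_one, ← sub_smul, norm_smul, S2.norm_coe, mul_one,
      Real.norm_eq_abs]
  have e2 : |1 - s| ≤ ‖s • (η : E3) - (θ : E3)‖ := by
    have := abs_norm_sub_norm_le (s • (η : E3)) (θ : E3)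
    rw [norm_smul, S2.norm_coe, S2.norm_coe, Real.norm_eq_abs, abs_of_pos hs, mul_one,
      abs_sub_comm] at this
    exact this
  calc ‖(η : E3) - θ‖ = ‖((η : E3) - s • (η : E3)) + (s • (η : E3) - θ)‖ := by congr 1; abel
    _ ≤ ‖(η : E3) - s • (η : E3)‖ + ‖s • (η : E3) - θ‖ := norm_add_le _ _
    _ ≤ 2 * ‖s • (η : E3) - θ‖ := by rw [e1]; linarith

theorem continuousOn_norm_sphereGradient {D : Set S2} (hD : IsOpen D) {ρ : S2 → ℝ}
    (hsmooth : ContMDiffOn (𝓡 2) 𝓘(ℝ, ℝ) ∞ ρ D) :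
    ContinuousOn (fun θ => ‖sphereGradient ρ θ‖) D := by
  have h1 : ContinuousOn (fderiv ℝ (radialExt ρ)) (coneOver D) :=
    (contDiffOn_radialExt hD hsmooth).continuousOn_fderiv_of_isOpen (isOpen_coneOver hD) (by simp)
  have h2 : ContinuousOn (fun θ : S2 => ‖fderiv ℝ (radialExt ρ) (θ : E3)‖) D :=
    (h1.comp continuous_subtype_val.continuousOn fun θ hθ => coe_mem_coneOver hθ).norm
  refine h2.congr fun θ _ => ?_
  simp [sphereGradient, gradient]

/-! ### The estimates on the domain -/

/-- The closure of a proper Lipschitz domain is not the whole sphere: the points just below the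
graph near a boundary point are exterior. -/
theorem IsLipschitzDomain.exists_notMem_closure {D : Set S2} (hD : IsLipschitzDomain D)
    (hne : D ≠ Set.univ) : ∃ p, p ∉ closure D := by
  have : PreconnectedSpace S2 := by
    refine Subtype.preconnectedSpace (isPreconnected_sphere ?_ 0 1)
    rw [← Module.finrank_eq_rank, finrank_euclideanSpace_fin]
    exact_mod_cast (by norm_num : 1 < 3)
  obtain ⟨p₀, hp₀⟩ := nonempty_frontier_iff.2 ⟨hD.isConnected.nonempty, hne⟩
  obtain ⟨e, -, U, hU, hpU, hUe, g, K, hg, hiff⟩ := hD.locally_epigraph p₀ hp₀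
  have hp₀D : p₀ ∉ D := by
    rw [hD.isOpen.frontier_eq] at hp₀
    exact hp₀.2
  have hle : e p₀ 1 ≤ g (e p₀ 0) := not_lt.1 fun h => hp₀D ((hiff p₀ hpU).2 h)
  -- Move down from the boundary point in the chart, by an amount `t`.
  set w : ℝ → EuclideanSpace ℝ (Fin 2) := fun t => e p₀ - t • EuclideanSpace.single 1 (1 : ℝ)
    with hw
  have hw0 : w 0 = e p₀ := by simp [hw]
  have hwc : ContinuousAt w 0 := by fun_prop
  have hpe : p₀ ∈ e.source := hUe hpU
  have htgt : ∀ᶠ t in 𝓝 (0 : ℝ), w t ∈ e.target :=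
    hwc.eventually (e.open_target.mem_nhds (by rw [hw0]; exact e.map_source hpe))
  have hsU : ∀ᶠ t in 𝓝 (0 : ℝ), e.symm (w t) ∈ U := by
    have hc : ContinuousAt e.symm (w 0) := by
      rw [hw0]
      exact e.continuousAt_symm (e.map_source hpe)
    refine (hc.comp hwc).eventually (hU.mem_nhds ?_)
    rwa [Function.comp_apply, hw0, e.left_inv hpe]
  obtain ⟨t, ⟨ht1, ht2⟩, ht0⟩ := (((htgt.and hsU).filter_mono nhdsWithin_le_nhds).and
    (self_mem_nhdsWithin (a := (0 : ℝ)) (s := Set.Ioi 0))).exists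
  have ht0 : 0 < t := ht0
  refine ⟨e.symm (w t), fun hcl => ?_⟩
  -- The points of `U` strictly below the graph form an open set that misses `D`.
  have hval : e (e.symm (w t)) = w t := e.right_inv ht1
  have hcont : ContinuousAt (fun q => g (e q 0) - e q 1) (e.symm (w t)) := by
    have he : ContinuousAt e (e.symm (w t)) := e.continuousAt (hUe ht2)
    have h0 : ContinuousAt (fun q => e q 0) (e.symm (w t)) :=
      (by fun_prop : Continuous fun z : EuclideanSpace ℝ (Fin 2) => z 0).continuousAt.comp he
    have h1 : ContinuousAt (fun q => e q 1) (e.symm (w t)) :=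
      (by fun_prop : Continuous fun z : EuclideanSpace ℝ (Fin 2) => z 1).continuousAt.comp he
    exact (hg.continuous.continuousAt.comp h0).sub h1
  have hpos : 0 < g (e (e.symm (w t)) 0) - e (e.symm (w t)) 1 := by
    rw [hval]
    simp only [hw, PiLp.sub_apply, PiLp.smul_apply]
    simp
    linarith
  have hnhds : ∀ᶠ q in 𝓝 (e.symm (w t)), q ∉ D := by
    filter_upwards [hcont.eventually (lt_mem_nhds hpos), hU.mem_nhds ht2] with q hq hqU hqD
    have := (hiff q hqU).1 hqD
    linarith
  obtain ⟨q, hq, hqD⟩ := mem_closure_iff_nhds.1 hcl _ hnhds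
  exact hq hqD

/-- Comparison with the barrier whose singular point is exterior to the domain. -/
theorem solution_lt {D : Set S2} (hD : IsLipschitzDomain D) (hne : D ≠ Set.univ) {ρ : S2 → ℝ}
    (hsmooth : ContMDiffOn (𝓡 2) 𝓘(ℝ, ℝ) ∞ ρ D) (hcont : ContinuousOn ρ (closure D))
    (hpos : ∀ θ ∈ D, 0 < ρ θ)
    (heq : ∀ θ ∈ D, ρ θ * sphereLaplacian ρ θ + ρ θ ^ 2 / 2
      = 3 / 2 * (‖sphereGradient ρ θ‖ ^ 2 - 1))
    (hbdry : ∀ θ ∈ frontier D, ρ θ = 0) {θ : S2} (hθ : θ ∈ D) : ρ θ < 4.2 := by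
  obtain ⟨p, hp⟩ := hD.exists_notMem_closure hne
  have hsol := isConeSolution_radialExt hD.isOpen hsmooth hpos heq
  set n : E3 := -(p : E3) with hn
  have hnn : ‖n‖ = 1 := by rw [hn, norm_neg, S2.norm_coe]
  have hin : ∀ η ∈ closure D, -1 < inner ℝ (η : E3) n := by
    intro η hη
    have h1 : inner ℝ (η : E3) (p : E3) < 1 := by
      refine (inner_lt_one_iff_real_of_norm_eq_one η.norm_coe p.norm_coe).2 fun h => hp ?_
      rwa [← Subtype.ext h]
    rw [hn, inner_neg_right]
    linarith
  have hB : Continuous fun η : S2 => barrier (inner ℝ (η : E3) n) :=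
    continuous_barrier.comp (by fun_prop)
  obtain ⟨θ₀, hθ₀, hmax⟩ := isClosed_closure.isCompact.exists_isMaxOn
    (hD.isConnected.nonempty.mono subset_closure)
    (hcont.div hB.continuousOn fun η hη => (barrier_pos (hin η hη)).ne')
  set k := ρ θ₀ / barrier (inner ℝ (θ₀ : E3) n) with hk
  have hle : ∀ η ∈ D, ρ η ≤ k * barrier (inner ℝ (η : E3) n) := fun η hη =>
    (div_le_iff₀ (barrier_pos (hin η (subset_closure hη)))).1 (hmax (subset_closure hη))
  have hkpos : 0 < k := lt_of_lt_of_le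
    (div_pos (hpos θ hθ) (barrier_pos (hin θ (subset_closure hθ)))) (hmax (subset_closure hθ))
  have hθ₀D : θ₀ ∈ D := by
    by_contra h
    have : θ₀ ∈ frontier D := by
      rw [hD.isOpen.frontier_eq]
      exact ⟨hθ₀, h⟩
    rw [hk, hbdry θ₀ this, zero_div] at hkpos
    exact lt_irrefl _ hkpos
  have hk₀ : ρ θ₀ = k * barrier (inner ℝ (θ₀ : E3) n) :=
    (div_mul_cancel₀ _ (barrier_pos (hin θ₀ hθ₀)).ne').symm
  have hk1 : k ≤ 1 := by
    refine hsol.le_one_of_contact (coe_mem_coneOver hθ₀D) θ₀.norm_coe hnn (hin θ₀ hθ₀)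
      (by rw [radialExt_coe, hk₀]) ?_
    filter_upwards [hsol.isOpen.mem_nhds (coe_mem_coneOver hθ₀D)] with x hx
    obtain ⟨η, hη, s, hs, rfl⟩ := mem_coneOver.1 hx
    rw [radialExt_smul_coe ρ η hs, radialExt_coe, S2.norm_coe, div_one, norm_smul, S2.norm_coe,
      Real.norm_eq_abs, abs_of_pos hs, mul_one, inner_smul_left]
    simp only [RCLike.conj_to_real]
    rw [mul_div_cancel_left₀ _ hs.ne']
    linarith [hle η hη]
  have hBθ := barrier_pos (hin θ (subset_closure hθ))
  calc ρ θ ≤ k * barrier (inner ℝ (θ : E3) n) := hle θ hθ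
    _ ≤ 1 * barrier (inner ℝ (θ : E3) n) := mul_le_mul_of_nonneg_right hk1 hBθ.le
    _ = barrier (inner ℝ (θ : E3) n) := one_mul _
    _ < 4.2 := barrier_lt (by
      have := real_inner_le_norm (θ : E3) n
      rwa [S2.norm_coe, hnn, mul_one] at this)

/-- Adding `ε log ρ` to a bounded function makes it attain its supremum in the domain, since the
sum tends to `-∞` at the boundary. -/
theorem exists_max_add_log {D : Set S2} (hDo : IsOpen D) {ρ Q : S2 → ℝ}
    (hcont : ContinuousOn ρ (closure D)) (hpos : ∀ θ ∈ D, 0 < ρ θ)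
    (hbdry : ∀ θ ∈ frontier D, ρ θ = 0) (hQ : ContinuousOn Q D) {C : ℝ} (hC : ∀ θ ∈ D, Q θ ≤ C)
    {ε : ℝ} (hε : 0 < ε) {θ₁ : S2} (hθ₁ : θ₁ ∈ D) :
    ∃ θ₀ ∈ D, ∀ θ ∈ D, Q θ + ε * Real.log (ρ θ) ≤ Q θ₀ + ε * Real.log (ρ θ₀) := by
  set q := Q θ₁ + ε * Real.log (ρ θ₁) with hq
  -- Where `ρ < r`, the penalized function is below its value at `θ₁`.
  set r := Real.exp ((q - C) / ε) with hr
  have hrpos : 0 < r := Real.exp_pos _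
  have hlow : ∀ θ ∈ D, ρ θ < r → Q θ + ε * Real.log (ρ θ) < q := by
    intro θ hθ h
    have h1 : Real.log (ρ θ) < (q - C) / ε := by
      rw [← Real.log_exp ((q - C) / ε)]
      exact Real.log_lt_log (hpos θ hθ) h
    rw [lt_div_iff₀ hε] at h1
    linarith [hC θ hθ]
  set S := closure D ∩ ρ ⁻¹' Set.Ici r with hS
  have hSc : IsCompact S := (hcont.preimage_isClosed_of_isClosed isClosed_closure
    isClosed_Ici).isCompact
  have hSD : S ⊆ D := by
    rintro θ ⟨hθ, hρ⟩
    by_contra h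
    have hf : θ ∈ frontier D := by
      rw [hDo.frontier_eq]
      exact ⟨hθ, h⟩
    have : r ≤ ρ θ := hρ
    rw [hbdry θ hf] at this
    linarith
  have hθ₁S : θ₁ ∈ S := ⟨subset_closure hθ₁, not_lt.1 fun h => lt_irrefl _ (hlow θ₁ hθ₁ h)⟩
  have hcS : ContinuousOn (fun θ => Q θ + ε * Real.log (ρ θ)) S :=
    (hQ.mono hSD).add (((hcont.mono Set.inter_subset_left).log
      fun θ hθ => (hpos θ (hSD hθ)).ne').const_mul ε)
  obtain ⟨θ₀, hθ₀, hmax⟩ := hSc.exists_isMaxOn ⟨θ₁, hθ₁S⟩ hcS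
  refine ⟨θ₀, hSD hθ₀, fun θ hθ => ?_⟩
  by_cases h : ρ θ < r
  · exact (hlow θ hθ h).le.trans (hmax hθ₁S)
  · exact hmax ⟨subset_closure hθ, not_lt.1 h⟩

/-- The maximum principle for `|∇ρ|² + a ρ²`: it cannot exceed `c` if, wherever it is at least `c`,
the gradient does not vanish and both factors of `IsConeSolution.factor_mul_factor_le`, taken
without the penalty, are nonnegative with product bounded away from zero. -/
theorem gradient_sq_add_le {D : Set S2} (hDo : IsOpen D) {ρ : S2 → ℝ}
    (hsmooth : ContMDiffOn (𝓡 2) 𝓘(ℝ, ℝ) ∞ ρ D) {K : NNReal}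
    (hlip : LipschitzOnWith K ρ (closure D)) (hpos : ∀ θ ∈ D, 0 < ρ θ)
    (heq : ∀ θ ∈ D, ρ θ * sphereLaplacian ρ θ + ρ θ ^ 2 / 2
      = 3 / 2 * (‖sphereGradient ρ θ‖ ^ 2 - 1))
    (hbdry : ∀ θ ∈ frontier D, ρ θ = 0) {M : ℝ} (hM : ∀ θ ∈ D, ρ θ < M) {a c κ : ℝ}
    (ha : 0 ≤ a) (hκ : 0 < κ)
    (H : ∀ θ ∈ D, c ≤ ‖sphereGradient ρ θ‖ ^ 2 + a * ρ θ ^ 2 →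
      0 < ‖sphereGradient ρ θ‖ ^ 2 ∧
      0 ≤ 3 / 2 * (‖sphereGradient ρ θ‖ ^ 2 - 1) + (2 * a - 1 / 2) * ρ θ ^ 2 ∧
      0 ≤ 1 / 2 * (‖sphereGradient ρ θ‖ ^ 2 - 3) + (a - 1 / 2) * ρ θ ^ 2 ∧
      κ ≤ (3 / 2 * (‖sphereGradient ρ θ‖ ^ 2 - 1) + (2 * a - 1 / 2) * ρ θ ^ 2)
        * (1 / 2 * (‖sphereGradient ρ θ‖ ^ 2 - 3) + (a - 1 / 2) * ρ θ ^ 2))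
    {θ₁ : S2} (hθ₁ : θ₁ ∈ D) : ‖sphereGradient ρ θ₁‖ ^ 2 + a * ρ θ₁ ^ 2 ≤ c := by
  by_contra! hlt
  have hsol := isConeSolution_radialExt hDo hsmooth hpos heq
  have hGC : ∀ θ ∈ D, ‖sphereGradient ρ θ‖ ^ 2 ≤ (2 * K) ^ 2 := fun θ hθ =>
    pow_le_pow_left₀ (norm_nonneg _)
      (norm_sphereGradient_le hDo (hlip.mono subset_closure) hθ) 2
  have hlogM : Real.log (ρ θ₁) < Real.log M := Real.log_lt_log (hpos θ₁ hθ₁) (hM θ₁ hθ₁)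
  -- The penalty is too small to push the value at the maximum below `c`, or to exceed `κ`.
  obtain ⟨ε, hε, hε1, hε2⟩ : ∃ ε > 0,
      ε * (Real.log M - Real.log (ρ θ₁)) ≤ ‖sphereGradient ρ θ₁‖ ^ 2 + a * ρ θ₁ ^ 2 - c ∧
      ε * ((2 * K) ^ 2 + 1) ≤ κ := by
    have h1 := sub_pos.2 hlogM
    have h2 : (0 : ℝ) < (2 * K) ^ 2 + 1 := by positivity
    refine ⟨min ((‖sphereGradient ρ θ₁‖ ^ 2 + a * ρ θ₁ ^ 2 - c)
      / (Real.log M - Real.log (ρ θ₁))) (κ / ((2 * K) ^ 2 + 1)), ?_, ?_, ?_⟩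
    · exact lt_min (div_pos (sub_pos.2 hlt) h1) (div_pos hκ h2)
    · rw [← le_div_iff₀ h1]
      exact min_le_left _ _
    · rw [← le_div_iff₀ h2]
      exact min_le_right _ _
  have hQc : ContinuousOn (fun θ => ‖sphereGradient ρ θ‖ ^ 2 + a * ρ θ ^ 2) D :=
    ((continuousOn_norm_sphereGradient hDo hsmooth).pow 2).add
      (((hlip.continuousOn.mono subset_closure).pow 2).const_mul a)
  have hQC : ∀ θ ∈ D, ‖sphereGradient ρ θ‖ ^ 2 + a * ρ θ ^ 2 ≤ (2 * K) ^ 2 + a * M ^ 2 :=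
    fun θ hθ => add_le_add (hGC θ hθ) (mul_le_mul_of_nonneg_left
      (pow_le_pow_left₀ (hpos θ hθ).le (hM θ hθ).le 2) ha)
  obtain ⟨θ₀, hθ₀, hmax⟩ := exists_max_add_log hDo hlip.continuousOn hpos hbdry hQc hQC hε hθ₁
  have hlog₀ : Real.log (ρ θ₀) < Real.log M := Real.log_lt_log (hpos θ₀ hθ₀) (hM θ₀ hθ₀)
  have hc₀ : c ≤ ‖sphereGradient ρ θ₀‖ ^ 2 + a * ρ θ₀ ^ 2 := by
    have h1 := hmax θ₁ hθ₁
    have h2 := mul_le_mul_of_nonneg_left hlog₀.le hε.le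
    linarith
  obtain ⟨hg, hA, hB, hAB⟩ := H θ₀ hθ₀ hc₀
  have key := hsol.factor_mul_factor_le (a := a) (ε := ε) (coe_mem_coneOver hθ₀) θ₀.norm_coe ?_ hg
  · rw [radialExt_coe] at key
    change (3 / 2 * (‖sphereGradient ρ θ₀‖ ^ 2 - 1) + (2 * a - 1 / 2) * ρ θ₀ ^ 2 + ε)
      * (1 / 2 * (‖sphereGradient ρ θ₀‖ ^ 2 - 3) + (a - 1 / 2) * ρ θ₀ ^ 2 + ε / 2)
      ≤ ε * ‖sphereGradient ρ θ₀‖ ^ 2 at key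
    have h1 := mul_le_mul_of_nonneg_left (hGC θ₀ hθ₀) hε.le
    have h2 := mul_le_mul (le_add_of_nonneg_right hε.le) (le_add_of_nonneg_right (half_pos hε).le)
      hB (add_nonneg hA hε.le)
    linarith
  · filter_upwards [hsol.isOpen.mem_nhds (coe_mem_coneOver hθ₀)] with x hx
    obtain ⟨η, hη, s, hs, rfl⟩ := mem_coneOver.1 hx
    have hn : ‖s • (η : E3)‖ = s := by
      rw [norm_smul, S2.norm_coe, Real.norm_eq_abs, abs_of_pos hs, mul_one]
    rw [hn, hsol.radial.norm_gradient_sq_smul hs, radialExt_smul_coe ρ η hs, radialExt_coe,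
      S2.norm_coe, one_pow, one_mul]
    exact hmax η hη

theorem mainTheorem8 (D : Set S2) (hD : IsLipschitzDomain D) (hne : D ≠ Set.univ)
    (ρ : S2 → ℝ)
    (hsmooth : ContMDiffOn (𝓡 2) 𝓘(ℝ, ℝ) ∞ ρ D)
    (hlip : ∃ K : NNReal, LipschitzOnWith K ρ (closure D))
    (hpos : ∀ θ ∈ D, 0 < ρ θ)
    (heq : ∀ θ ∈ D, ρ θ * sphereLaplacian ρ θ + ρ θ ^ 2 / 2
      = 3 / 2 * (‖sphereGradient ρ θ‖ ^ 2 - 1))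
    (hbdry : ∀ θ ∈ frontier D, ρ θ = 0) :
    (∀ θ ∈ D, ρ θ < 4.2) ∧ (∀ θ ∈ D, ‖sphereGradient ρ θ‖ < 2.8) := by
  obtain ⟨K, hlip⟩ := hlip
  have hρ : ∀ θ ∈ D, ρ θ < 4.2 := fun θ hθ =>
    solution_lt hD hne hsmooth hlip.continuousOn hpos heq hbdry hθ
  have hsq : ∀ θ ∈ D, ρ θ ^ 2 ≤ 17.64 := fun θ hθ =>
    (pow_le_pow_left₀ (hpos θ hθ).le (hρ θ hθ).le 2).trans (by norm_num)
  -- With `M = 4.2`, the weight `0.585` is `1 / 2 + 3 / (2 M²)` rounded down, which balances the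
  -- bound at critical points of `ρ` and the bound at the other maxima, both close to `10.32`.
  have step : ∀ θ ∈ D, ‖sphereGradient ρ θ‖ ^ 2 + 0.585 * ρ θ ^ 2 ≤ 10.4 := fun θ hθ => by
    refine gradient_sq_add_le hD.isOpen hsmooth hlip hpos heq hbdry hρ (κ := 0.3)
      (by norm_num) (by norm_num) (fun η hη hc => ?_) hθ
    have hs := hsq η hη
    have hA : 10 ≤ 3 / 2 * (‖sphereGradient ρ η‖ ^ 2 - 1) + (2 * 0.585 - 1 / 2) * ρ η ^ 2 := by
      linarith
    have hB : 0.03 ≤ 1 / 2 * (‖sphereGradient ρ η‖ ^ 2 - 3) + (0.585 - 1 / 2) * ρ η ^ 2 := by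
      linarith
    refine ⟨by linarith, by linarith, by linarith, ?_⟩
    exact le_trans (by norm_num) (mul_le_mul hA hB (by norm_num) (by linarith))
  have hgrad : ∀ θ ∈ D, ‖sphereGradient ρ θ‖ ^ 2 + 0 * ρ θ ^ 2 ≤ 7.8 := fun θ hθ => by
    refine gradient_sq_add_le hD.isOpen hsmooth hlip hpos heq hbdry hρ (κ := 0.1)
      le_rfl (by norm_num) (fun η hη hc => ?_) hθ
    have hs := step η hη
    have hA : 1 ≤ 3 / 2 * (‖sphereGradient ρ η‖ ^ 2 - 1) + (2 * 0 - 1 / 2) * ρ η ^ 2 := by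
      linarith
    have hB : 0.1 ≤ 1 / 2 * (‖sphereGradient ρ η‖ ^ 2 - 3) + (0 - 1 / 2) * ρ η ^ 2 := by
      linarith
    refine ⟨by linarith, by linarith, by linarith, ?_⟩
    exact le_trans (by norm_num) (mul_le_mul hA hB (by norm_num) (by linarith))
  refine ⟨hρ, fun θ hθ => ?_⟩
  have h := hgrad θ hθ
  refine lt_of_pow_lt_pow_left₀ 2 (by norm_num) ?_
  norm_num at h ⊢
  linarith
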